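/- For $f\in\mathbb{Z}[x]$, the height of $f$ is the maximal modulus of its coefficients. Call $u\in\mathbb{Z}[x]$ powerful if $u\in\mathbb{Z}[x^m]$ for some $m\ge 2$. For $a,b\in\mathbb{Z}[x]$ with root sets $A,B\subset\overline{\mathbb{Q}}$, call $a$ a closed divisor of $b$ if $a$ divides $b$ in $\mathbb{Z}[x]$ and: (i) every powerful divisor of $b$ divides $a$; (ii) $(A\cdot A)\cap B\subseteq A$, where $A\cdot A=\{yz : y,z\in A\}$; (iii) $\gcd(a,b/a)=1$ in $\mathbb{Z}[x]$. Define $\Delta:\mathbb{Z}[x]\to\mathbb{Z}[x]$ as follows. If $f$ is constant, then $\Delta(f):=f$. Otherwise let $\|f\|$ be the maximal $m$ with $f\in\mathbb{Z}[x^m]$, let $\overline f\in\mathbb{Z}[x]$ be the unique polynomial with $f(x)=\overline f(x^{\|f\|})$, and let $\Delta(f)$ be the greatest common divisor of all closed divisors of $\overline f$ (determined up to sign, which is irrelevant below). A polynomial $f\in\mathbb{Z}[x]$ is Higman-solvable if $f(0)\cdot f(1)\ne 0$ and $\Delta^l(f)\in\mathbb{Z}$ for some integer $l\ge 0$; its Higman-length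 is then the minimal such $l$. **Proposition.** Fix integers $c\ge 1$ and $d_1,n_1,\dots,d_c,n_c\ge 1$, and set $k:=\#\{i : 1\le i\le c-1,\ n_i\ge 2\}$. For each integer $h\ge 1$, consider the finite set of all $c$-tuples $(g_1,\dots,g_c)$ of monic polynomials in $\mathbb{Z}[x]$ with $\deg g_i=d_i$ and height at most $h$ for all $i$, and let $P(h)$ be the proportion of these tuples for which the product $$f(x)=g_1(x^{n_1n_2\cdots n_c})\,g_2(x^{n_2\cdots n_c})\cdots g_{c-1}(x^{n_{c-1}n_c})\,g_c(x^{n_c})$$ is Higman-solvable of Higman-length exactly $1+k$. Then $\lim_{h\to+\infty}P(h)=1$. -/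

import Mathlib

open Polynomial

noncomputable section

namespace Higman

/-- `f ∈ ℤ[x ^ n]`. -/
def InPowers (n : ℕ) (f : ℤ[X]) : Prop :=
  ∃ g : ℤ[X], f = g.comp (X ^ n)

/-- `a` is powerful: it lies in `ℤ[x²] ∪ ℤ[x³] ∪ ℤ[x⁴] ∪ ⋯`. -/
def IsPowerful (a : ℤ[X]) : Prop :=
  ∃ n : ℕ, 2 ≤ n ∧ InPowers n a

/-- The set of all roots of `a` in an algebraic closure of the rational numbers. -/
def algRoots (a : ℤ[X]) : Set (AlgebraicClosure ℚ) :=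
  {z | aeval z a = 0}

/-- `a` is a closed divisor of `b`. The polynomial `q` is the quotient `b / a`. -/
structure IsClosedDivisor (a b : ℤ[X]) : Prop where
  powerful_dvd : ∀ u : ℤ[X], IsPowerful u → u ∣ b → u ∣ a
  mul_roots : ∀ y ∈ algRoots a, ∀ z ∈ algRoots a, y * z ∈ algRoots b → y * z ∈ algRoots a
  exists_quotient : ∃ q : ℤ[X], b = a * q ∧ IsRelPrime a q

/-- `f ∈ ℤ`, that is, `f` is a constant polynomial. -/
def IsConst (f : ℤ[X]) : Prop :=
  ∃ e : ℤ, f = C e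

open Classical in
/-- `‖f‖`: zero for constant `f`, and otherwise the maximal `n` with `f ∈ ℤ[x ^ n]`
(the set of such `n` is then bounded by the degree of `f`, see `le_of_inPowers`). -/
def powNorm (f : ℤ[X]) : ℕ :=
  if IsConst f then 0 else sSup {n : ℕ | InPowers n f}

open Classical in
/-- The polynomial `f̄` with `f(x) = f̄(x ^ ‖f‖)`, see `bar_comp`. -/
def bar (f : ℤ[X]) : ℤ[X] :=
  if IsConst f then f else contract (powNorm f) f

theorem le_of_inPowers {f : ℤ[X]} (hf : ¬ IsConst f) {n : ℕ} (h : InPowers n f) :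
    n ≤ f.natDegree := by
  obtain ⟨g, rfl⟩ := h
  rw [natDegree_comp, natDegree_X_pow]
  rcases Nat.eq_zero_or_pos g.natDegree with h0 | h0
  · exfalso
    apply hf
    obtain ⟨e, rfl⟩ := natDegree_eq_zero.1 h0
    exact ⟨e, by simp⟩
  · exact Nat.le_mul_of_pos_left n h0

theorem inPowers_powNorm {f : ℤ[X]} (hf : ¬ IsConst f) : InPowers (powNorm f) f := by
  rw [powNorm, if_neg hf]
  have hne : {n : ℕ | InPowers n f}.Nonempty := ⟨1, f, by simp⟩
  exact Nat.sSup_mem hne ⟨f.natDegree, fun n hn => le_of_inPowers hf hn⟩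

theorem bar_comp (f : ℤ[X]) : f = (bar f).comp (X ^ powNorm f) := by
  by_cases hf : IsConst f
  · rw [bar, if_pos hf]
    obtain ⟨e, rfl⟩ := hf
    rw [C_comp]
  · obtain ⟨g, hg⟩ := inPowers_powNorm hf
    have h0 : powNorm f ≠ 0 := by
      intro h
      rw [h] at hg
      exact hf ⟨g.eval 1, by rw [hg, pow_zero, ← C_1, comp_C]⟩
    have hbar : bar f = g := by
      rw [bar, if_neg hf]
      generalize powNorm f = m at hg h0
      rw [hg, ← expand_eq_comp_X_pow]
      exact contract_expand _ h0
    rw [hbar]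
    exact hg

theorem bar_ne_zero {f : ℤ[X]} (hf : ¬ IsConst f) : bar f ≠ 0 := by
  intro h
  apply hf
  refine ⟨0, ?_⟩
  have h2 := bar_comp f
  rw [h] at h2
  simpa using h2

theorem finite_closedDivisors {b : ℤ[X]} (hb : b ≠ 0) : {a : ℤ[X] | IsClosedDivisor a b}.Finite := by
  have : Finite (ℤ[X])ˣ := by
    refine Finite.of_injective (β := ℤˣ) (fun u => Units.map (evalRingHom (0 : ℤ)).toMonoidHom u) ?_
    intro u v huv
    obtain ⟨a, -, ha⟩ := isUnit_iff.1 u.isUnit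
    obtain ⟨b, -, hb⟩ := isUnit_iff.1 v.isUnit
    have h := congrArg Units.val huv
    apply Units.ext
    rw [← ha, ← hb]
    simp [← ha, ← hb] at h
    rw [h]
  have := Fintype.ofFinite (ℤ[X])ˣ
  have := UniqueFactorizationMonoid.fintypeSubtypeDvd b hb
  have hfin : {a : ℤ[X] | a ∣ b}.Finite :=
    Set.finite_coe_iff.1 (inferInstanceAs (Finite {a : ℤ[X] // a ∣ b}))
  refine hfin.subset ?_
  rintro a ⟨-, -, q, hq, -⟩
  exact ⟨q, hq⟩

open Classical in
/-- `Δ(f) = f_*`: the polynomial `f` itself if `f` is constant, and otherwise the greatest common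
divisor in `ℤ[x]` of the finitely many closed divisors of `f̄` (normalized by a sign). -/
def delta (f : ℤ[X]) : ℤ[X] :=
  if hf : IsConst f then f else (finite_closedDivisors (bar_ne_zero hf)).toFinset.gcd id

/-- `f` is Higman-solvable: `f(0) * f(1) ≠ 0` and some iterate `Δ^l(f)` is a constant. -/
def IsSolvable (f : ℤ[X]) : Prop :=
  f.eval 0 * f.eval 1 ≠ 0 ∧ ∃ l : ℕ, IsConst (delta^[l] f)

/-- The Higman-length of a Higman-solvable `f`: the minimal `l` such that `Δ^l(f)` is a constant. -/
def length (f : ℤ[X]) : ℕ :=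
  sInf {l : ℕ | IsConst (delta^[l] f)}

/-- The height of `f`: the maximal modulus of its coefficients. -/
def height (f : ℤ[X]) : ℕ :=
  f.support.sup fun j => (f.coeff j).natAbs

/-- The tuples `(g₁, …, g_c)` of monic polynomials of degrees `d₁, …, d_c` and heights at most `h`. -/
def tuples {c : ℕ} (d : Fin c → ℕ) (h : ℕ) : Set (Fin c → ℤ[X]) :=
  {g | ∀ i, (g i).Monic ∧ (g i).natDegree = d i ∧ height (g i) ≤ h}

/-- `g₁(x ^ (n₁ ⋯ n_c)) * g₂(x ^ (n₂ ⋯ n_c)) * ⋯ * g_c(x ^ n_c)`. -/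
def nestedProduct {c : ℕ} (n : Fin c → ℕ) (g : Fin c → ℤ[X]) : ℤ[X] :=
  ∏ i, (g i).comp (X ^ (∏ j ∈ Finset.Ici i, n j))

/-- `k`: the number of indices `i ≤ c - 1` (with the indices running from `1` to `c`, so that the
last index is left out) such that `n_i ≥ 2`. -/
def numProper {c : ℕ} (n : Fin c → ℕ) : ℕ :=
  (Finset.univ.filter fun i : Fin c => (i : ℕ) + 1 < c ∧ 2 ≤ n i).card

/-- The probability, for the uniform distribution on the finite set `tuples d h`, that the nested
product is Higman-solvable of Higman-length `1 + k`. -/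
def prob {c : ℕ} (d n : Fin c → ℕ) (h : ℕ) : ℝ :=
  (({g ∈ tuples d h | IsSolvable (nestedProduct n g) ∧
      length (nestedProduct n g) = 1 + numProper n}.ncard : ℕ) : ℝ) / ((tuples d h).ncard : ℝ)

theorem finite_tuples {c : ℕ} (d : Fin c → ℕ) (h : ℕ) : (tuples d h).Finite := by
  have key : ∀ m : ℕ, {f : ℤ[X] | f.natDegree = m ∧ height f ≤ h}.Finite := by
    intro m
    have hS : (Set.pi Set.univ fun _ : Fin (m + 1) => Set.Icc (-(h : ℤ)) h).Finite :=
      Set.Finite.pi fun _ => Set.finite_Icc _ _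
    refine Set.Finite.of_injOn (f := fun (f : ℤ[X]) (j : Fin (m + 1)) => f.coeff j) ?_ ?_ hS
    · rintro f ⟨-, hf⟩ j -
      have hle : (f.coeff j).natAbs ≤ h := by
        by_cases hj : (j : ℕ) ∈ f.support
        · exact (Finset.le_sup (f := fun j => (f.coeff j).natAbs) hj).trans hf
        · simp [notMem_support_iff.1 hj]
      simp only [Set.mem_Icc]
      omega
    · rintro f ⟨hf, -⟩ g ⟨hg, -⟩ hfg
      ext j
      by_cases hj : j < m + 1
      · exact congrFun hfg ⟨j, hj⟩
      · rw [coeff_eq_zero_of_natDegree_lt (by omega), coeff_eq_zero_of_natDegree_lt (by omega)]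
  refine (Set.Finite.pi fun i => key (d i)).subset ?_
  intro g hg i _
  exact (hg i).2

end Higman

end

/-!
Write `f = ∏ g_i(x ^ E_i)`. The exponents `E_i = n_i ⋯ n_c` form a divisibility chain with exactly
`1 + k` distinct values. For generic `g_i`, one application of `Δ` deletes the factors with the
smallest exponent `m` and divides the remaining exponents by `m`. Hence the length is the number of
distinct exponents (`IsGeneric.isConst_iterate_iff`).

To see this, let `F = P * Q` be the product with exponents `E_i / m`, where `Q` collects the factors
with exponent one. The exponents in `P` have a common divisor at least two, so `P` is powerful and
divides every closed divisor of `F`. It remains that `‖f‖ = m` and that `P` is itself a closed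
divisor (`IsGeneric.powNorm_expProduct`, `IsGeneric.isClosedDivisor`). All of this follows from two
properties of the roots of a factor `g_j` (`IsGeneric`):

* no root of `g_j` is a product of two numbers each of which is `0`, a root of unity of bounded
  order, or an `e`-th root of a root of some other `g_i`, with `e` bounded;
* if `β` is a root of `g_j` and `ζ ≠ 1` is a root of unity of bounded order, then `ζβ` is not a
  root of `g_j`.

Indeed, a powerful polynomial in `x ^ r` has a root set stable under the `r`-th roots of unity, so
these properties forbid it to share a root with `Q` when it divides `F`. No irreducibility of the
factors is needed.

The two properties fail for a proportion `O(1 / h)` of the tuples. Fix all coefficients of the tuple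
but the constant one of `g_j`. The first property fails only if `g_j` vanishes somewhere on a fixed
finite set of bounded size, and each of its elements excludes one value of the constant
coefficient. For the second property, `g_j(ζx) - g_j(x)` does not involve the constant coefficient, and it is a nonzero
polynomial as soon as the coefficient of `x` in `g_j` is nonzero; so `β` again lies in a fixed
finite set of bounded size (`negligible_of_root_mem`, `negligible_not_isGeneric`).
-/

noncomputable section

namespace Higman

variable {ι : Type*}

/-! ### Products of polynomials in powers of the variable -/

/-- The product of the `g i (x ^ e i)` over `i ∈ s`. -/
def expProduct (s : Finset ι) (e : ι → ℕ) (g : ι → ℤ[X]) : ℤ[X] :=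
  ∏ i ∈ s, (g i).comp (X ^ e i)

theorem aeval_comp_X_pow (z : AlgebraicClosure ℚ) (p : ℤ[X]) (e : ℕ) :
    aeval z (p.comp (X ^ e)) = aeval (z ^ e) p := by
  rw [aeval_comp]; simp

theorem aeval_expProduct_eq_zero {s : Finset ι} {e : ι → ℕ} {g : ι → ℤ[X]}
    {z : AlgebraicClosure ℚ} :
    aeval z (expProduct s e g) = 0 ↔ ∃ i ∈ s, aeval (z ^ e i) (g i) = 0 := by
  simp only [expProduct, map_prod, Finset.prod_eq_zero_iff, aeval_comp_X_pow]

theorem monic_comp_X_pow {p : ℤ[X]} (hp : p.Monic) {e : ℕ} (he : 1 ≤ e) :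
    (p.comp (X ^ e)).Monic :=
  hp.comp (monic_X_pow e) (by rw [natDegree_X_pow]; omega)

theorem monic_expProduct {s : Finset ι} {e : ι → ℕ} {g : ι → ℤ[X]} (hg : ∀ i, (g i).Monic)
    (he : ∀ i ∈ s, 1 ≤ e i) : (expProduct s e g).Monic :=
  monic_prod_of_monic _ _ fun i hi => monic_comp_X_pow (hg i) (he i hi)

theorem natDegree_expProduct {s : Finset ι} {e : ι → ℕ} {g : ι → ℤ[X]} (hg : ∀ i, (g i).Monic)
    (he : ∀ i ∈ s, 1 ≤ e i) :
    (expProduct s e g).natDegree = ∑ i ∈ s, (g i).natDegree * e i := by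
  rw [expProduct, natDegree_prod_of_monic _ _ fun i hi => monic_comp_X_pow (hg i) (he i hi)]
  simp [natDegree_comp]

theorem expProduct_comp_X_pow (s : Finset ι) (e : ι → ℕ) (g : ι → ℤ[X]) (m : ℕ) :
    (expProduct s e g).comp (X ^ m) = expProduct s (fun i => m * e i) g := by
  rw [expProduct, expProduct, prod_comp]
  refine Finset.prod_congr rfl fun i _ => ?_
  rw [comp_assoc, X_pow_comp, pow_mul]

theorem expProduct_filter_mul (s : Finset ι) (e : ι → ℕ) (g : ι → ℤ[X]) :
    expProduct s e g =
      expProduct (s.filter (e · ≠ 1)) e g * expProduct (s.filter (¬ e · ≠ 1)) e g :=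
  (Finset.prod_filter_mul_prod_filter_not s _ _).symm

/-- In a divisibility chain of positive integers, the smallest one divides all others. -/
theorem exists_min_dvd {s : Finset ι} (hs : s.Nonempty) {E : ι → ℕ} (hE : ∀ i ∈ s, 1 ≤ E i)
    (hchain : ∀ i ∈ s, ∀ j ∈ s, E i ∣ E j ∨ E j ∣ E i) :
    ∃ j ∈ s, ∀ i ∈ s, E j ∣ E i := by
  obtain ⟨j, hj, hmin⟩ := Finset.exists_min_image s E hs
  refine ⟨j, hj, fun i hi => (hchain j hj i hi).elim id fun h => ?_⟩
  rw [le_antisymm (hmin i hi) (Nat.le_of_dvd (hE j hj) h)]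

theorem isPowerful_expProduct {s : Finset ι} {e : ι → ℕ} (he : ∀ i ∈ s, 2 ≤ e i)
    (hchain : ∀ i ∈ s, ∀ j ∈ s, e i ∣ e j ∨ e j ∣ e i) (g : ι → ℤ[X]) :
    IsPowerful (expProduct s e g) := by
  rcases s.eq_empty_or_nonempty with rfl | hs
  · exact ⟨2, le_rfl, 1, by simp [expProduct]⟩
  · obtain ⟨j, hj, hdvd⟩ := exists_min_dvd hs (fun i hi => (he i hi).trans' one_le_two) hchain
    refine ⟨e j, he j hj, expProduct s (fun i => e i / e j) g, ?_⟩
    rw [expProduct_comp_X_pow]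
    exact Finset.prod_congr rfl fun i hi => by simp only [Nat.mul_div_cancel' (hdvd i hi)]

theorem isConst_iff {f : ℤ[X]} : IsConst f ↔ f.natDegree = 0 := by
  rw [natDegree_eq_zero]
  exact ⟨fun ⟨e, h⟩ => ⟨e, h.symm⟩, fun ⟨e, h⟩ => ⟨e, h.symm⟩⟩

/-! ### Divisibility in `ℤ[x]` and roots -/

/-- A divisor of a monic polynomial has a unit as leading coefficient, so it is a unit as soon as it
has no root. -/
theorem exists_root_of_dvd_monic {d q : ℤ[X]} (hq : q.Monic) (h : d ∣ q) (hd : ¬ IsUnit d) :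
    ∃ β : AlgebraicClosure ℚ, aeval β d = 0 := by
  refine IsAlgClosed.exists_aeval_eq_zero _ d fun h0 => hd ?_
  rw [eq_C_of_degree_eq_zero h0] at h ⊢
  obtain ⟨r, rfl⟩ := h
  refine isUnit_C.2 (IsUnit.of_mul_eq_one r.leadingCoeff ?_)
  rwa [Monic, leadingCoeff_mul, leadingCoeff_C] at hq

theorem isRelPrime_of_no_common_root {p q : ℤ[X]} (hq : q.Monic)
    (h : ∀ β : AlgebraicClosure ℚ, aeval β q = 0 → aeval β p ≠ 0) : IsRelPrime p q := by
  intro d hp hdq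
  by_contra hd
  obtain ⟨β, hβ⟩ := exists_root_of_dvd_monic hq hdq hd
  exact h β (aeval_eq_zero_of_dvd_aeval_eq_zero hdq hβ)
    (aeval_eq_zero_of_dvd_aeval_eq_zero hp hβ)

theorem exists_root_of_natDegree_pos {p : ℤ[X]} (hd : 1 ≤ p.natDegree) :
    ∃ β : AlgebraicClosure ℚ, aeval β p = 0 :=
  IsAlgClosed.exists_aeval_eq_zero _ p fun h0 => by
    rw [natDegree_eq_of_degree_eq_some (n := 0) (by simpa using h0)] at hd; omega

theorem exists_primitiveRoot {n : ℕ} (hn : 1 ≤ n) :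
    ∃ ζ : AlgebraicClosure ℚ, IsPrimitiveRoot ζ n := by
  have : NeZero n := ⟨by omega⟩
  exact HasEnoughRootsOfUnity.exists_primitiveRoot _ n

/-- A monic closed divisor that is powerful divides all closed divisors, hence is their gcd. -/
theorem gcd_closedDivisors {b P : ℤ[X]} (hb : b ≠ 0) (hP : P.Monic) (hpow : IsPowerful P)
    (hcl : IsClosedDivisor P b) : (finite_closedDivisors hb).toFinset.gcd id = P := by
  obtain ⟨q, hq, -⟩ := hcl.exists_quotient
  have h1 : (finite_closedDivisors hb).toFinset.gcd id ∣ P :=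
    Finset.gcd_dvd (f := id) (by simpa using hcl)
  have h2 : P ∣ (finite_closedDivisors hb).toFinset.gcd id := by
    refine Finset.dvd_gcd fun a ha => ?_
    have ha : IsClosedDivisor a b := by simpa using ha
    exact ha.powerful_dvd P hpow ⟨q, hq⟩
  have h3 := normalize_eq_normalize h1 h2
  rw [Finset.normalize_gcd] at h3
  rw [h3]
  exact hP.normalize_eq_self

/-! ### Genericity conditions -/

variable [Fintype ι] [DecidableEq ι]

/-- The polynomial whose roots are `0`, the roots of unity of order at most `D`, and all `e`-th
roots (`1 ≤ e ≤ D`) of roots of the polynomials `g i` with `i ≠ j`. It does not depend on `g j`. -/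
def sievePoly (D : ℕ) (g : ι → ℤ[X]) (j : ι) : ℤ[X] :=
  X * (∏ m ∈ Finset.Icc 1 D, (X ^ m - 1)) *
    ∏ i ∈ Finset.univ.erase j, ∏ e ∈ Finset.Icc 1 D, (g i).comp (X ^ e)

/-- The genericity condition: no root of `g j` is a product of two roots of `sievePoly D g j`, and
multiplying a root of `g j` by a root of unity `ζ ≠ 1` of order at most `D` never gives a root. -/
structure IsGeneric (D : ℕ) (g : ι → ℤ[X]) : Prop where
  mul_ne : ∀ (j : ι) (y z : AlgebraicClosure ℚ), aeval y (sievePoly D g j) = 0 →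
    aeval z (sievePoly D g j) = 0 → aeval (y * z) (g j) ≠ 0
  twist_ne : ∀ (j : ι) (β ζ : AlgebraicClosure ℚ) (m : ℕ), 1 ≤ m → m ≤ D → ζ ^ m = 1 → ζ ≠ 1 →
    aeval β (g j) = 0 → aeval (ζ * β) (g j) ≠ 0

theorem aeval_zero_sievePoly (D : ℕ) (g : ι → ℤ[X]) (j : ι) :
    aeval (0 : AlgebraicClosure ℚ) (sievePoly D g j) = 0 := by
  simp [sievePoly]

theorem aeval_sievePoly_of_pow_eq_one {D m : ℕ} (g : ι → ℤ[X]) (j : ι) (h1 : 1 ≤ m) (hm : m ≤ D)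
    {ζ : AlgebraicClosure ℚ} (hζ : ζ ^ m = 1) : aeval ζ (sievePoly D g j) = 0 := by
  have : aeval ζ (∏ m ∈ Finset.Icc 1 D, (X ^ m - 1 : ℤ[X])) = 0 := by
    rw [map_prod]
    exact Finset.prod_eq_zero (Finset.mem_Icc.2 ⟨h1, hm⟩) (by simp [hζ])
  simp [sievePoly, this]

theorem aeval_sievePoly_of_root {D e : ℕ} {g : ι → ℤ[X]} {i j : ι} (hij : i ≠ j) (h1 : 1 ≤ e)
    (he : e ≤ D) {z : AlgebraicClosure ℚ} (hz : aeval (z ^ e) (g i) = 0) :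
    aeval z (sievePoly D g j) = 0 := by
  have : aeval z (∏ i ∈ Finset.univ.erase j, ∏ e ∈ Finset.Icc 1 D, (g i).comp (X ^ e)) = 0 := by
    rw [map_prod]
    refine Finset.prod_eq_zero (Finset.mem_erase.2 ⟨hij, Finset.mem_univ i⟩) ?_
    rw [map_prod]
    exact Finset.prod_eq_zero (Finset.mem_Icc.2 ⟨h1, he⟩) (by rw [aeval_comp_X_pow, hz])
  rw [sievePoly, map_mul, this, mul_zero]

/-! ### The closed divisor -/

/-- Multiplying a root of a factor that occurs with exponent one by a root of unity `ζ ≠ 1` of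
bounded order never gives a root of the product. -/
theorem IsGeneric.eq_one_of_root {D : ℕ} {g : ι → ℤ[X]} (hG : IsGeneric D g) {s : Finset ι}
    {e : ι → ℕ} (he : ∀ i ∈ s, 1 ≤ e i ∧ e i ≤ D) {j : ι} (hej : e j = 1)
    {β ζ : AlgebraicClosure ℚ} (hβ : aeval β (g j) = 0) {n : ℕ} (h1 : 1 ≤ n) (hn : n ≤ D)
    (hζ : ζ ^ n = 1) (h : aeval (ζ * β) (expProduct s e g) = 0) : ζ = 1 := by
  by_contra hne
  obtain ⟨i, hi, hroot⟩ := aeval_expProduct_eq_zero.1 h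
  by_cases hij : i = j
  · subst hij
    rw [hej, pow_one] at hroot
    exact hG.twist_ne i β ζ n h1 hn hζ hne hβ hroot
  · have h0 : ζ ≠ 0 := by rintro rfl; rw [zero_pow (by omega)] at hζ; exact zero_ne_one hζ
    -- `β` is the product of the root of unity `ζ⁻¹` and an `e i`-th root of a root of `g i`.
    refine hG.mul_ne j ζ⁻¹ (ζ * β)
      (aeval_sievePoly_of_pow_eq_one g j h1 hn (by rw [inv_pow, hζ, inv_one]))
      (aeval_sievePoly_of_root hij (he i hi).1 (he i hi).2 hroot) ?_
    rwa [inv_mul_cancel_left₀ h0]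

/-- The factors with exponent different from one form a closed divisor of a generic product. -/
theorem IsGeneric.isClosedDivisor {D : ℕ} {g : ι → ℤ[X]} (hG : IsGeneric D g)
    (hg : ∀ i, (g i).Monic) {s : Finset ι} {e : ι → ℕ} (he : ∀ i ∈ s, 1 ≤ e i ∧ e i ≤ D)
    (hD : (expProduct s e g).natDegree ≤ D) (hD1 : 1 ≤ D) :
    IsClosedDivisor (expProduct (s.filter (e · ≠ 1)) e g) (expProduct s e g) := by
  set P := expProduct (s.filter (e · ≠ 1)) e g with hP
  set Q := expProduct (s.filter (¬ e · ≠ 1)) e g with hQ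
  have hPQ : expProduct s e g = P * Q := expProduct_filter_mul s e g
  have hQm : Q.Monic := monic_expProduct hg fun i hi => (he i (Finset.mem_filter.1 hi).1).1
  have hFm : (expProduct s e g).Monic := monic_expProduct hg fun i hi => (he i hi).1
  have hQroot : ∀ {β : AlgebraicClosure ℚ}, aeval β Q = 0 →
      ∃ j ∈ s, e j = 1 ∧ aeval β (g j) = 0 := by
    intro β hβ
    obtain ⟨j, hj, hβ⟩ := aeval_expProduct_eq_zero.1 hβ
    rw [Finset.mem_filter, not_not] at hj
    rw [hj.2, pow_one] at hβ
    exact ⟨j, hj.1, hj.2, hβ⟩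
  have hProot : ∀ {y : AlgebraicClosure ℚ} {j : ι}, aeval y P = 0 → e j = 1 →
      aeval y (sievePoly D g j) = 0 := by
    intro y j hy hj
    obtain ⟨i, hi, hy⟩ := aeval_expProduct_eq_zero.1 hy
    rw [Finset.mem_filter] at hi
    refine aeval_sievePoly_of_root ?_ (he i hi.1).1 (he i hi.1).2 hy
    rintro rfl
    exact hi.2 hj
  refine ⟨?_, ?_, Q, hPQ, ?_⟩
  · rintro u ⟨n, hn2, v, hv⟩ hu
    rw [hPQ] at hu
    refine IsRelPrime.dvd_of_dvd_mul_right ?_ hu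
    refine isRelPrime_of_no_common_root hQm fun β hβ huβ => ?_
    obtain ⟨j, hj, hej, hβj⟩ := hQroot hβ
    rw [← hPQ] at hu
    have hu0 : u ≠ 0 := ne_zero_of_dvd_ne_zero hFm.ne_zero hu
    -- A nonzero polynomial with a root is not constant, so the order `n` is at most its degree.
    have hnc : ¬ IsConst u := by
      rintro ⟨a, rfl⟩
      rw [aeval_C] at huβ
      have ha : a = 0 := by simpa using huβ
      exact hu0 (by rw [ha, C_0])
    have hnD : n ≤ D :=
      (le_of_inPowers hnc ⟨v, hv⟩).trans ((natDegree_le_of_dvd hu hFm.ne_zero).trans hD)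
    obtain ⟨ζ, hζ⟩ := exists_primitiveRoot (n := n) (by omega)
    have hζβ : aeval (ζ * β) u = 0 := by
      rw [hv, aeval_comp_X_pow] at huβ ⊢
      rwa [mul_pow, hζ.pow_eq_one, one_mul]
    have := hG.eq_one_of_root he hej hβj (by omega) hnD hζ.pow_eq_one
      (aeval_eq_zero_of_dvd_aeval_eq_zero hu hζβ)
    exact hζ.ne_one (by omega) this
  · intro y hy z hz hyz
    simp only [algRoots, Set.mem_ofPred_eq] at hy hz hyz ⊢
    rw [hPQ, map_mul, mul_eq_zero] at hyz
    refine hyz.resolve_right fun hyz => ?_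
    obtain ⟨j, hj, hej, hβj⟩ := hQroot hyz
    exact hG.mul_ne j y z (hProot hy hej) (hProot hz hej) hβj
  · refine isRelPrime_of_no_common_root hQm fun β hβ hPβ => ?_
    obtain ⟨j, hj, hej, hβj⟩ := hQroot hβ
    refine hG.mul_ne j β 1 (hProot hPβ hej)
      (aeval_sievePoly_of_pow_eq_one g j le_rfl hD1 (pow_one 1)) ?_
    rwa [mul_one]

theorem IsGeneric.powNorm_expProduct {D : ℕ} {g : ι → ℤ[X]} (hG : IsGeneric D g)
    (hg : ∀ i, (g i).Monic) (hdeg : ∀ i, 1 ≤ (g i).natDegree) {s : Finset ι} {e : ι → ℕ}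
    (he : ∀ i ∈ s, 1 ≤ e i ∧ e i ≤ D) {j : ι} (hj : j ∈ s) (hej : e j = 1) {m : ℕ} (hm : 1 ≤ m)
    (hD : ((expProduct s e g).comp (X ^ m)).natDegree ≤ D) :
    ¬ IsConst ((expProduct s e g).comp (X ^ m)) ∧
      powNorm ((expProduct s e g).comp (X ^ m)) = m := by
  have hnc : ¬ IsConst ((expProduct s e g).comp (X ^ m)) := by
    rw [isConst_iff, natDegree_comp, natDegree_X_pow,
      natDegree_expProduct hg fun i hi => (he i hi).1]
    have : 1 ≤ ∑ i ∈ s, (g i).natDegree * e i :=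
      le_trans (by rw [hej, mul_one]; exact hdeg j)
        (Finset.single_le_sum (f := fun i => (g i).natDegree * e i) (fun _ _ => Nat.zero_le _) hj)
    exact (Nat.mul_pos this hm).ne'
  refine ⟨hnc, ?_⟩
  rw [powNorm, if_neg hnc]
  have hub : ∀ n, InPowers n ((expProduct s e g).comp (X ^ m)) → n ≤ m := by
    intro n hn
    rcases Nat.eq_zero_or_pos n with rfl | hn0
    · omega
    have hnD : n ≤ D := (le_of_inPowers hnc hn).trans hD
    obtain ⟨β, hβ⟩ := exists_root_of_natDegree_pos (hdeg j)
    obtain ⟨γ, hγ⟩ := IsAlgClosed.exists_pow_nat_eq β hm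
    obtain ⟨ζ, hζ⟩ := exists_primitiveRoot hn0
    obtain ⟨v, hv⟩ := hn
    -- The set of roots is stable under `ζ`, so `ζ ^ m` moves `β` to a root of the product.
    have h1 : aeval γ ((expProduct s e g).comp (X ^ m)) = 0 := by
      rw [aeval_comp_X_pow, hγ]
      exact aeval_expProduct_eq_zero.2 ⟨j, hj, by rwa [hej, pow_one]⟩
    have h2 : aeval (ζ * γ) ((expProduct s e g).comp (X ^ m)) = 0 := by
      rw [hv, aeval_comp_X_pow] at h1 ⊢
      rwa [mul_pow, hζ.pow_eq_one, one_mul]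
    rw [aeval_comp_X_pow, mul_pow, hγ] at h2
    have h3 := hG.eq_one_of_root he hej hβ hn0 hnD
      (by rw [← pow_mul, mul_comm, pow_mul, hζ.pow_eq_one, one_pow]) h2
    exact Nat.le_of_dvd hm (hζ.dvd_of_pow_eq_one m h3)
  exact IsGreatest.csSup_eq ⟨⟨_, rfl⟩, hub⟩

/-- One application of `Δ` removes the factors with the smallest exponent `m` and divides the
remaining exponents by `m`. -/
theorem IsGeneric.delta_expProduct {D : ℕ} {g : ι → ℤ[X]} (hG : IsGeneric D g)
    (hg : ∀ i, (g i).Monic) (hdeg : ∀ i, 1 ≤ (g i).natDegree) {s : Finset ι} {e : ι → ℕ}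
    (he : ∀ i ∈ s, 1 ≤ e i) {j : ι} (hj : j ∈ s) (hej : e j = 1) {m : ℕ} (hm : 1 ≤ m)
    (hchain : ∀ i ∈ s, ∀ j ∈ s, e i ∣ e j ∨ e j ∣ e i)
    (hD : ∑ i ∈ s, (g i).natDegree * (m * e i) ≤ D) :
    ¬ IsConst ((expProduct s e g).comp (X ^ m)) ∧
      delta ((expProduct s e g).comp (X ^ m)) = expProduct (s.filter (e · ≠ 1)) e g := by
  have heD : ∀ i ∈ s, 1 ≤ e i ∧ e i ≤ D := fun i hi => ⟨he i hi, by
    refine le_trans ?_ ((Finset.single_le_sum (f := fun i => (g i).natDegree * (m * e i))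
      (fun _ _ => Nat.zero_le _) hi).trans hD)
    calc e i = 1 * (1 * e i) := by ring
      _ ≤ _ := Nat.mul_le_mul (hdeg i) (Nat.mul_le_mul_right _ hm)⟩
  have hD1 : 1 ≤ D := (heD j hj).1.trans (heD j hj).2
  have hD2 : ((expProduct s e g).comp (X ^ m)).natDegree ≤ D := by
    rwa [expProduct_comp_X_pow, natDegree_expProduct hg]
    exact fun i hi => Nat.mul_pos hm (he i hi)
  have hD3 : (expProduct s e g).natDegree ≤ D := by
    refine le_trans ?_ hD2
    rw [natDegree_comp, natDegree_X_pow]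
    exact Nat.le_mul_of_pos_right _ hm
  obtain ⟨hnc, hnorm⟩ := hG.powNorm_expProduct hg hdeg heD hj hej hm hD2
  have hbar : bar ((expProduct s e g).comp (X ^ m)) = expProduct s e g := by
    rw [bar, if_neg hnc, hnorm, ← expand_eq_comp_X_pow]
    exact contract_expand _ (by omega)
  have hmon : (expProduct (s.filter (e · ≠ 1)) e g).Monic :=
    monic_expProduct hg fun i hi => he i (Finset.mem_filter.1 hi).1
  refine ⟨hnc, ?_⟩
  rw [delta, dif_neg hnc]
  refine gcd_closedDivisors (bar_ne_zero hnc) hmon (isPowerful_expProduct ?_ ?_ g) ?_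
  · intro i hi
    rw [Finset.mem_filter] at hi
    have := he i hi.1
    have := hi.2
    omega
  · exact fun i hi k hk => hchain i (Finset.mem_filter.1 hi).1 k (Finset.mem_filter.1 hk).1
  · rw [hbar]
    exact hG.isClosedDivisor hg heD hD3 hD1

theorem delta_iterate_of_isConst {f : ℤ[X]} (hf : IsConst f) (l : ℕ) : delta^[l] f = f :=
  Function.iterate_fixed (by rw [delta, dif_pos hf]) l

/-- For generic factors, the number of steps that `Δ` takes to reach a constant is the number of
distinct exponents. -/
theorem IsGeneric.isConst_iterate_iff {D : ℕ} {g : ι → ℤ[X]} (hG : IsGeneric D g)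
    (hg : ∀ i, (g i).Monic) (hdeg : ∀ i, 1 ≤ (g i).natDegree) (s : Finset ι) (E : ι → ℕ)
    (hE : ∀ i ∈ s, 1 ≤ E i) (hchain : ∀ i ∈ s, ∀ j ∈ s, E i ∣ E j ∨ E j ∣ E i)
    (hD : ∑ i ∈ s, (g i).natDegree * E i ≤ D) (l : ℕ) :
    IsConst (delta^[l] (expProduct s E g)) ↔ (s.image E).card ≤ l := by
  induction s using Finset.strongInduction generalizing E l with
  | H s ih =>
  rcases s.eq_empty_or_nonempty with rfl | hs
  · have h1 : IsConst (expProduct ∅ E g) := ⟨1, by simp [expProduct]⟩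
    rw [delta_iterate_of_isConst h1]
    simp [h1]
  obtain ⟨j, hj, hdvd⟩ := exists_min_dvd hs hE hchain
  obtain ⟨m, hmj⟩ : ∃ m, m = E j := ⟨_, rfl⟩
  rw [← hmj] at hdvd
  have hm : 1 ≤ m := hmj ▸ hE j hj
  set e : ι → ℕ := fun i => E i / m with he_def
  have hmul : ∀ i ∈ s, m * e i = E i := fun i hi => Nat.mul_div_cancel' (hdvd i hi)
  have he : ∀ i ∈ s, 1 ≤ e i := fun i hi =>
    Nat.pos_of_mul_pos_left (a := m) (by rw [hmul i hi]; exact hE i hi)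
  have hej : e j = 1 := by simp only [he_def, ← hmj]; exact Nat.div_self hm
  have hchain' : ∀ i ∈ s, ∀ k ∈ s, e i ∣ e k ∨ e k ∣ e i := by
    intro i hi k hk
    have := hchain i hi k hk
    rwa [← hmul i hi, ← hmul k hk, Nat.mul_dvd_mul_iff_left hm, Nat.mul_dvd_mul_iff_left hm]
      at this
  have hf : expProduct s E g = (expProduct s e g).comp (X ^ m) := by
    rw [expProduct_comp_X_pow]
    exact Finset.prod_congr rfl fun i hi => by simp only [hmul i hi]
  have hsum : ∑ i ∈ s, (g i).natDegree * (m * e i) ≤ D := by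
    rwa [Finset.sum_congr rfl fun i hi => by rw [hmul i hi]]
  obtain ⟨hnc, hdelta⟩ := hG.delta_expProduct hg hdeg he hj hej hm hchain' hsum
  -- Dividing by `m` is injective on the exponents, and the removed factors share one exponent.
  have hcard : (s.image E).card = ((s.filter (e · ≠ 1)).image e).card + 1 := by
    have h1 : s.image E = (s.image e).image (m * ·) := by
      rw [Finset.image_image]
      exact Finset.image_congr fun i hi => (hmul i hi).symm
    have h2 : s.image e = insert 1 ((s.filter (e · ≠ 1)).image e) := by
      ext x
      simp only [Finset.mem_image, Finset.mem_insert, Finset.mem_filter]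
      constructor
      · rintro ⟨i, hi, rfl⟩
        by_cases h : e i = 1
        · exact Or.inl h
        · exact Or.inr ⟨i, ⟨hi, h⟩, rfl⟩
      · rintro (rfl | ⟨i, ⟨hi, -⟩, rfl⟩)
        · exact ⟨j, hj, hej⟩
        · exact ⟨i, hi, rfl⟩
    rw [h1, Finset.card_image_of_injective _ fun a b h => Nat.eq_of_mul_eq_mul_left hm h, h2,
      Finset.card_insert_of_notMem]
    simp
  rw [hf, hcard]
  cases l with
  | zero => simpa using hnc
  | succ l =>
    rw [Function.iterate_succ_apply, hdelta, Nat.add_le_add_iff_right]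
    refine ih _ ?_ e (fun i hi => he i (Finset.mem_filter.1 hi).1)
      (fun i hi k hk => hchain' i (Finset.mem_filter.1 hi).1 k (Finset.mem_filter.1 hk).1) ?_ l
    · exact Finset.filter_ssubset.2 ⟨j, hj, by simpa using hej⟩
    · refine le_trans ?_ hsum
      refine (Finset.sum_le_sum fun i _ => ?_).trans
        (Finset.sum_le_sum_of_subset (Finset.filter_subset _ s))
      exact Nat.mul_le_mul_left _ (Nat.le_mul_of_pos_left _ hm)

theorem IsGeneric.eval_expProduct_ne_zero {D : ℕ} (hD : 1 ≤ D) {g : ι → ℤ[X]}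
    (hG : IsGeneric D g) {s : Finset ι} {E : ι → ℕ} (hE : ∀ i ∈ s, 1 ≤ E i) :
    (expProduct s E g).eval 0 * (expProduct s E g).eval 1 ≠ 0 := by
  have key : ∀ a : ℤ, (∀ i, aeval (a : AlgebraicClosure ℚ) (g i) ≠ 0) → ∀ i, (g i).eval a ≠ 0 := by
    intro a ha i h
    apply ha i
    have := aeval_algebraMap_apply_eq_algebraMap_eval (A := AlgebraicClosure ℚ) a (g i)
    rw [h, map_zero] at this
    simpa using this
  have h0 := key 0 fun i h => hG.mul_ne i 0 0
    (aeval_zero_sievePoly D g i) (aeval_zero_sievePoly D g i) (by simpa using h)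
  have h1 := key 1 fun i h => hG.mul_ne i 1 1
    (aeval_sievePoly_of_pow_eq_one g i le_rfl hD (pow_one 1))
    (aeval_sievePoly_of_pow_eq_one g i le_rfl hD (pow_one 1)) (by simpa using h)
  simp only [expProduct, eval_prod, eval_comp, eval_pow, eval_X]
  refine mul_ne_zero (Finset.prod_ne_zero_iff.2 fun i hi => ?_)
    (Finset.prod_ne_zero_iff.2 fun i hi => ?_)
  · rw [zero_pow (by have := hE i hi; omega)]; exact h0 i
  · rw [one_pow]; exact h1 i

/-! ### The exponents of a nested product -/

theorem nestedExponent_dvd {c : ℕ} (n : Fin c → ℕ) {i i' : Fin c} (h : i ≤ i') :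
    ∏ j ∈ Finset.Ici i', n j ∣ ∏ j ∈ Finset.Ici i, n j :=
  Finset.prod_dvd_prod_of_subset _ _ _ (Finset.Ici_subset_Ici.2 h)

theorem nestedExponent_succ {c : ℕ} (n : Fin c → ℕ) (i : Fin c) (h : (i : ℕ) + 1 < c) :
    ∏ j ∈ Finset.Ici i, n j = n i * ∏ j ∈ Finset.Ici (⟨i + 1, h⟩ : Fin c), n j := by
  rw [← Finset.prod_insert (f := n) (by simp [Fin.le_def])]
  refine Finset.prod_congr ?_ fun _ _ => rfl
  ext k
  simp only [Finset.mem_Ici, Finset.mem_insert, Fin.le_def, Fin.ext_iff]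
  omega

/-- The exponents of a nested product take `1 + k` values: each value is attained for the last
time at the last index or at an index `i` with `n i ≥ 2`. -/
theorem card_image_nestedExponent {c : ℕ} (hc : 1 ≤ c) {n : Fin c → ℕ} (hn : ∀ i, 1 ≤ n i) :
    (Finset.univ.image fun i : Fin c => ∏ j ∈ Finset.Ici i, n j).card = 1 + numProper n := by
  set E : Fin c → ℕ := fun i => ∏ j ∈ Finset.Ici i, n j with hE
  have hpos : ∀ i, 1 ≤ E i := fun i => Nat.one_le_iff_ne_zero.2
    (Finset.prod_ne_zero_iff.2 fun j _ => Nat.one_le_iff_ne_zero.1 (hn j))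
  have hanti : ∀ {i i'}, i ≤ i' → E i' ≤ E i := fun {i i'} h =>
    Nat.le_of_dvd (hpos i) (nestedExponent_dvd n h)
  set R : Finset (Fin c) := Finset.univ.filter fun i => (i : ℕ) + 1 < c → 2 ≤ n i with hR
  have himage : Finset.univ.image E = R.image E := by
    refine le_antisymm ?_ (Finset.image_subset_image (Finset.subset_univ R))
    intro x hx
    obtain ⟨i, -, rfl⟩ := Finset.mem_image.1 hx
    obtain ⟨k, hk, hmax⟩ := Finset.exists_max_image (Finset.univ.filter fun k => E k = E i)
      (fun k => k) ⟨i, by simp⟩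
    have hk := (Finset.mem_filter.1 hk).2
    refine Finset.mem_image.2 ⟨k, Finset.mem_filter.2 ⟨Finset.mem_univ k, fun hkc => ?_⟩, hk⟩
    by_contra hlt
    have h1 : n k = 1 := by have := hn k; omega
    have h2 : E k = E ⟨k + 1, hkc⟩ := by
      have := nestedExponent_succ n k hkc
      rwa [h1, one_mul] at this
    have := hmax ⟨k + 1, hkc⟩ (Finset.mem_filter.2 ⟨Finset.mem_univ _, by rw [← h2, hk]⟩)
    simp [Fin.le_def] at this
  have hinj : Set.InjOn E R := by
    have hlt : ∀ i ∈ R, ∀ i', i < i' → E i' < E i := by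
      intro i hi i' h
      have hic : (i : ℕ) + 1 < c := lt_of_le_of_lt (Nat.succ_le_of_lt h) i'.2
      have h2 := (Finset.mem_filter.1 hi).2 hic
      have h3 : E i = n i * E ⟨i + 1, hic⟩ := nestedExponent_succ n i hic
      have h4 : E i' ≤ E ⟨i + 1, hic⟩ := hanti (Fin.le_def.2 (Nat.succ_le_of_lt h))
      have h5 := hpos ⟨i + 1, hic⟩
      rw [h3]
      nlinarith
    intro i hi i' hi' h
    rcases lt_trichotomy i i' with h' | h' | h'
    · exact absurd h (hlt i hi i' h').ne'
    · exact h'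
    · exact absurd h (hlt i' hi' i h').ne
  rw [himage, Finset.card_image_of_injOn hinj, numProper]
  have hlast : R = insert ⟨c - 1, by omega⟩
      (Finset.univ.filter fun i : Fin c => (i : ℕ) + 1 < c ∧ 2 ≤ n i) := by
    ext i
    simp only [hR, Finset.mem_filter, Finset.mem_univ, true_and, Finset.mem_insert, Fin.ext_iff]
    have := i.2
    constructor
    · intro h
      by_cases hi : (i : ℕ) + 1 < c
      · exact Or.inr ⟨hi, h hi⟩
      · left; omega
    · rintro (h | h) hi
      · omega
      · exact h.2
  rw [hlast, Finset.card_insert_of_notMem, add_comm]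
  simp only [Finset.mem_filter, Finset.mem_univ, true_and, not_and]
  omega

theorem IsGeneric.isSolvable_and_length_nestedProduct {c : ℕ} (hc : 1 ≤ c)
    {d n : Fin c → ℕ} (hd : ∀ i, 1 ≤ d i) (hn : ∀ i, 1 ≤ n i) {g : Fin c → ℤ[X]}
    (hg : ∀ i, (g i).Monic) (hdeg : ∀ i, (g i).natDegree = d i)
    (hG : IsGeneric (∑ i, d i * ∏ j ∈ Finset.Ici i, n j) g) :
    IsSolvable (nestedProduct n g) ∧ length (nestedProduct n g) = 1 + numProper n := by
  set E : Fin c → ℕ := fun i => ∏ j ∈ Finset.Ici i, n j with hE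
  have hpos : ∀ i, 1 ≤ E i := fun i => Nat.one_le_iff_ne_zero.2
    (Finset.prod_ne_zero_iff.2 fun j _ => Nat.one_le_iff_ne_zero.1 (hn j))
  have hD : 1 ≤ ∑ i, d i * E i :=
    (Nat.mul_pos (hd ⟨0, hc⟩) (hpos ⟨0, hc⟩)).trans_le
      (Finset.single_le_sum (f := fun i => d i * E i) (fun _ _ => Nat.zero_le _)
        (Finset.mem_univ _))
  have hf : Higman.nestedProduct n g = expProduct Finset.univ E g := rfl
  have key := hG.isConst_iterate_iff hg (fun i => hdeg i ▸ hd i) Finset.univ E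
    (fun i _ => hpos i)
    (fun i _ i' _ => (le_total i i').symm.imp (nestedExponent_dvd n) (nestedExponent_dvd n))
    (by simp_rw [hdeg]; exact le_rfl)
  rw [card_image_nestedExponent hc hn, ← hf] at key
  refine ⟨⟨hf ▸ hG.eval_expProduct_ne_zero hD fun i _ => hpos i, _, (key _).2 le_rfl⟩, ?_⟩
  rw [length]
  simp_rw [key]
  exact IsLeast.csInf_eq ⟨by simp, fun l hl => by simpa using hl⟩

/-! ### Counting tuples with a negligible property -/

variable {c : ℕ}

/-- The property `p` holds for a proportion `O(1 / h)` of the tuples of height at most `h`. -/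
def Negligible (d : Fin c → ℕ) (p : (Fin c → ℤ[X]) → Prop) : Prop :=
  ∃ C : ℕ, ∀ h : ℕ, {g ∈ tuples d h | p g}.ncard * (2 * h + 1) ≤ C * (tuples d h).ncard

theorem Negligible.mono {d : Fin c → ℕ} {p q : (Fin c → ℤ[X]) → Prop} (hq : Negligible d q)
    (h : ∀ k, ∀ g ∈ tuples d k, p g → q g) : Negligible d p := by
  obtain ⟨C, hC⟩ := hq
  refine ⟨C, fun k => (Nat.mul_le_mul_right _ (Set.ncard_le_ncard ?_ ?_)).trans (hC k)⟩
  · exact fun g hg => ⟨hg.1, h k g hg.1 hg.2⟩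
  · exact (finite_tuples d k).subset fun g hg => hg.1

theorem Negligible.or {d : Fin c → ℕ} {p q : (Fin c → ℤ[X]) → Prop} (hp : Negligible d p)
    (hq : Negligible d q) : Negligible d fun g => p g ∨ q g := by
  obtain ⟨C, hC⟩ := hp
  obtain ⟨C', hC'⟩ := hq
  refine ⟨C + C', fun k => ?_⟩
  have h1 : {g ∈ tuples d k | p g ∨ q g} = {g ∈ tuples d k | p g} ∪ {g ∈ tuples d k | q g} := by
    ext g
    simp only [Set.mem_ofPred_eq, Set.mem_union]
    tauto
  rw [h1, add_mul]
  refine (Nat.mul_le_mul_right _ (Set.ncard_union_le _ _)).trans ?_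
  rw [add_mul]
  exact Nat.add_le_add (hC k) (hC' k)

theorem Negligible.exists_fin {d : Fin c → ℕ} {p : Fin c → (Fin c → ℤ[X]) → Prop}
    (hp : ∀ j, Negligible d (p j)) : Negligible d fun g => ∃ j, p j g := by
  have key : ∀ s : Finset (Fin c), Negligible d fun g => ∃ j ∈ s, p j g := by
    intro s
    classical
    induction s using Finset.induction with
    | empty => exact ⟨0, fun k => by simp⟩
    | insert j s _ ih =>
      refine ((hp j).or ih).mono fun k g _ hg => ?_
      obtain ⟨i, hi, hg⟩ := hg
      rcases Finset.mem_insert.1 hi with rfl | hi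
      · exact Or.inl hg
      · exact Or.inr ⟨i, hi, hg⟩
  exact (key Finset.univ).mono fun k g _ ⟨j, hj⟩ => ⟨j, Finset.mem_univ j, hj⟩

theorem height_le_iff {p : ℤ[X]} {h : ℕ} : height p ≤ h ↔ ∀ k, (p.coeff k).natAbs ≤ h := by
  rw [height, Finset.sup_le_iff]
  refine ⟨fun H k => ?_, fun H k _ => H k⟩
  by_cases hk : k ∈ p.support
  · exact H k hk
  · simp [notMem_support_iff.1 hk]

theorem update_mem_tuples {d : Fin c → ℕ} {h : ℕ} {g : Fin c → ℤ[X]} (hg : g ∈ tuples d h)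
    {j : Fin c} {l : ℕ} (hl : l < d j) {a : ℤ} (ha : a.natAbs ≤ h) :
    Function.update g j ((g j).update l a) ∈ tuples d h := by
  intro i
  rcases eq_or_ne i j with rfl | hij
  · obtain ⟨hm, hd, hh⟩ := hg i
    rw [Function.update_self]
    have hlt : (C (a - (g i).coeff l) * X ^ l).degree < (g i).degree := by
      refine (degree_C_mul_X_pow_le l _).trans_lt ?_
      rw [degree_eq_natDegree hm.ne_zero, hd]
      exact_mod_cast hl
    refine ⟨?_, ?_, height_le_iff.2 fun k => ?_⟩
    · rw [update_eq_add_sub_coeff]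
      exact hm.add_of_left hlt
    · rw [update_eq_add_sub_coeff, natDegree_add_eq_left_of_degree_lt hlt, hd]
    · rw [coeff_update_apply]
      split_ifs
      · exact ha
      · exact height_le_iff.1 hh k
  · rw [Function.update_of_ne hij]
    exact hg i

/-- The tuple `g` without the coefficient of `x ^ l` in `g j`. -/
def forgetCoeff (j : Fin c) (l : ℕ) (g : Fin c → ℤ[X]) : Fin c → ℤ[X] :=
  Function.update g j ((g j).erase l)

theorem forgetCoeff_injective {j : Fin c} {l : ℕ} {g g' : Fin c → ℤ[X]}
    (h : forgetCoeff j l g = forgetCoeff j l g') (hl : (g j).coeff l = (g' j).coeff l) :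
    g = g' := by
  funext i
  have hi := congrFun h i
  rcases eq_or_ne i j with rfl | hij
  · simp only [forgetCoeff, Function.update_self] at hi
    rw [← monomial_add_erase (g i) l, ← monomial_add_erase (g' i) l, hi, hl]
  · simpa [forgetCoeff, Function.update_of_ne hij] using hi

/-- If all other coefficients leave at most `C` values for the coefficient of `x ^ l` in `g j`,
then the property is negligible: that coefficient takes each of `2 * h + 1` values in a tuple. -/
theorem negligible_of_coeff_mem {d : Fin c → ℕ} {p : (Fin c → ℤ[X]) → Prop} {j : Fin c} {l : ℕ}
    (hl : l < d j) (A : (Fin c → ℤ[X]) → Finset (AlgebraicClosure ℚ)) (C : ℕ)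
    (hA : ∀ h, ∀ g ∈ tuples d h, (A (forgetCoeff j l g)).card ≤ C)
    (hp : ∀ h, ∀ g ∈ tuples d h, p g →
      ((g j).coeff l : AlgebraicClosure ℚ) ∈ A (forgetCoeff j l g)) : Negligible d p := by
  classical
  refine ⟨C, fun h => ?_⟩
  set T := (finite_tuples d h).toFinset with hT
  have hmemT : ∀ {g}, g ∈ T ↔ g ∈ tuples d h := by simp [hT]
  have h1 : (tuples d h).ncard = T.card := Set.ncard_eq_toFinset_card _ _
  have h2 : {g ∈ tuples d h | p g}.ncard = (T.filter p).card := by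
    rw [← Set.ncard_coe_finset]
    congr 1
    ext g
    simp [hmemT]
  rw [h1, h2]
  -- The fibres of `forgetCoeff j l` have at most `C` elements with property `p`.
  have h3 : (T.filter p).card ≤ C * ((T.filter p).image (forgetCoeff j l)).card := by
    refine Finset.card_le_mul_card_image _ _ fun b hb => ?_
    obtain ⟨g, hg, rfl⟩ := Finset.mem_image.1 hb
    refine le_trans (Finset.card_le_card_of_injOn
      (fun g' => ((g' j).coeff l : AlgebraicClosure ℚ)) ?_ ?_)
      (hA h g (hmemT.1 (Finset.mem_filter.1 hg).1))
    · intro g' hg'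
      simp only [Finset.coe_filter, Finset.mem_filter, Set.mem_ofPred_eq] at hg'
      rw [← hg'.2]
      exact hp h g' (hmemT.1 hg'.1.1) hg'.1.2
    · intro g' hg' g'' hg'' heq
      simp only [Finset.coe_filter, Finset.mem_filter, Set.mem_ofPred_eq] at hg' hg''
      exact forgetCoeff_injective (hg'.2.trans hg''.2.symm) (Int.cast_injective heq)
  -- The fibres of `forgetCoeff j l` have at least `2 * h + 1` elements.
  have h4 : (2 * h + 1) * (T.image (forgetCoeff j l)).card ≤ T.card := by
    refine Finset.mul_card_image_le_card _ _ fun b hb => ?_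
    obtain ⟨g, hg, rfl⟩ := Finset.mem_image.1 hb
    have hcard : (Finset.Icc (-(h : ℤ)) h).card = 2 * h + 1 := by
      rw [Int.card_Icc]; omega
    rw [← hcard]
    refine Finset.card_le_card_of_injOn (fun a => Function.update g j ((g j).update l a)) ?_ ?_
    · intro a ha
      simp only [Finset.coe_Icc, Set.mem_Icc] at ha
      simp only [Finset.coe_filter, Set.mem_ofPred_eq]
      refine ⟨hmemT.2 (update_mem_tuples (hmemT.1 hg) hl (by omega)), ?_⟩
      rw [forgetCoeff, forgetCoeff, Function.update_idem, Function.update_self]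
      congr 1
      ext k
      simp only [coeff_erase, coeff_update_apply]
      split_ifs <;> rfl
    · intro a _ a' _ heq
      have := congrArg (fun q : ℤ[X] => q.coeff l) (congrFun heq j)
      simpa [coeff_update_apply] using this
  calc (T.filter p).card * (2 * h + 1)
      ≤ C * ((T.filter p).image (forgetCoeff j l)).card * (2 * h + 1) :=
        Nat.mul_le_mul_right _ h3
    _ ≤ C * (T.image (forgetCoeff j l)).card * (2 * h + 1) := by
        gcongr
        exact Finset.filter_subset _ _
    _ = C * ((2 * h + 1) * (T.image (forgetCoeff j l)).card) := by ring
    _ ≤ C * T.card := Nat.mul_le_mul_left _ h4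

theorem coeff_zero_eq_neg_aeval_erase {p : ℤ[X]} {β : AlgebraicClosure ℚ} (h : aeval β p = 0) :
    (p.coeff 0 : AlgebraicClosure ℚ) = -aeval β (p.erase 0) := by
  rw [eq_neg_iff_add_eq_zero, ← h]
  conv_rhs => rw [← monomial_add_erase p 0]
  simp

/-- If a finite set of bounded size, which does not depend on the constant coefficient of `g j`,
contains a root of `g j`, then this coefficient takes a bounded number of values. -/
theorem negligible_of_root_mem {d : Fin c → ℕ} {p : (Fin c → ℤ[X]) → Prop} {j : Fin c}
    (hl : 0 < d j) (V : (Fin c → ℤ[X]) → Finset (AlgebraicClosure ℚ)) (C : ℕ)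
    (hV : ∀ h, ∀ g ∈ tuples d h, (V (forgetCoeff j 0 g)).card ≤ C)
    (hp : ∀ h, ∀ g ∈ tuples d h, p g →
      ∃ β ∈ V (forgetCoeff j 0 g), aeval β (g j) = 0) : Negligible d p := by
  classical
  refine negligible_of_coeff_mem hl (fun g => (V g).image fun β => -aeval β (g j)) C
    (fun h g hg => Finset.card_image_le.trans (hV h g hg)) fun h g hg hpg => ?_
  obtain ⟨β, hβ, hroot⟩ := hp h g hg hpg
  refine Finset.mem_image.2 ⟨β, hβ, ?_⟩
  rw [coeff_zero_eq_neg_aeval_erase hroot, forgetCoeff, Function.update_self]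

/-! ### Genericity holds for almost all tuples -/

theorem sievePoly_forgetCoeff (D : ℕ) (g : Fin c → ℤ[X]) (j : Fin c) (l : ℕ) :
    sievePoly D (forgetCoeff j l g) j = sievePoly D g j := by
  rw [sievePoly, sievePoly]
  congr 1
  refine Finset.prod_congr rfl fun i hi => ?_
  rw [forgetCoeff, Function.update_of_ne (Finset.ne_of_mem_erase hi)]

theorem monic_prod_X_pow_sub_one (D : ℕ) : (∏ m ∈ Finset.Icc 1 D, (X ^ m - 1 : ℤ[X])).Monic :=
  monic_prod_of_monic _ _ fun m hm =>
    monic_X_pow_sub_C (1 : ℤ) (by have := (Finset.mem_Icc.1 hm).1; omega)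

theorem monic_sievePoly (D : ℕ) {g : Fin c → ℤ[X]} (hg : ∀ i, (g i).Monic) (j : Fin c) :
    (sievePoly D g j).Monic :=
  (monic_X.mul (monic_prod_X_pow_sub_one D)).mul <|
    monic_prod_of_monic _ _ fun i _ => monic_prod_of_monic _ _ fun _ he =>
      monic_comp_X_pow (hg i) (Finset.mem_Icc.1 he).1

theorem exists_natDegree_sievePoly (d : Fin c → ℕ) (D : ℕ) (j : Fin c) :
    ∃ N : ℕ, ∀ h, ∀ g ∈ tuples d h, (sievePoly D g j).natDegree = N := by
  refine ⟨(X * ∏ m ∈ Finset.Icc 1 D, (X ^ m - 1 : ℤ[X])).natDegree +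
    ∑ i ∈ Finset.univ.erase j, ∑ e ∈ Finset.Icc 1 D, d i * e, fun h g hg => ?_⟩
  have hmon : ∀ i, ∀ e ∈ Finset.Icc 1 D, ((g i).comp (X ^ e)).Monic := fun i e he =>
    monic_comp_X_pow (hg i).1 (Finset.mem_Icc.1 he).1
  rw [sievePoly, (monic_X.mul (monic_prod_X_pow_sub_one D)).natDegree_mul
    (monic_prod_of_monic _ _ fun i _ => monic_prod_of_monic _ _ (hmon i))]
  congr 1
  rw [natDegree_prod_of_monic _ _ fun i _ => monic_prod_of_monic _ _ (hmon i)]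
  have : ∀ i, (∏ e ∈ Finset.Icc 1 D, (g i).comp (X ^ e)).natDegree =
      ∑ e ∈ Finset.Icc 1 D, d i * e := by
    intro i
    rw [natDegree_prod_of_monic _ _ (hmon i)]
    simp [natDegree_comp, (hg i).2.1]
  exact Finset.sum_congr rfl fun i _ => this i

open Classical in
/-- The roots of `p` in the algebraic closure, as a finite set. -/
def rootFinset (p : ℤ[X]) : Finset (AlgebraicClosure ℚ) :=
  (p.aroots (AlgebraicClosure ℚ)).toFinset

theorem mem_rootFinset {p : ℤ[X]} (hp : p ≠ 0) {z : AlgebraicClosure ℚ} :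
    z ∈ rootFinset p ↔ aeval z p = 0 := by
  classical
  rw [rootFinset, Multiset.mem_toFinset, mem_aroots]
  exact and_iff_right hp

theorem card_rootFinset_le (p : ℤ[X]) : (rootFinset p).card ≤ p.natDegree := by
  classical
  exact (Multiset.toFinset_card_le _).trans ((card_roots' _).trans natDegree_map_le)

/-- The polynomial `sievePoly D g j` does not involve `g j` and has bounded degree, so the products
of two of its roots form a finite set of bounded size, independent of `g j`. -/
theorem negligible_mul_root {d : Fin c → ℕ} {j : Fin c} (hd : 0 < d j) (D : ℕ) :
    Negligible d fun g => ∃ y z : AlgebraicClosure ℚ, aeval y (sievePoly D g j) = 0 ∧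
      aeval z (sievePoly D g j) = 0 ∧ aeval (y * z) (g j) = 0 := by
  classical
  obtain ⟨N, hN⟩ := exists_natDegree_sievePoly d D j
  refine negligible_of_root_mem hd (fun g => (rootFinset (sievePoly D g j) ×ˢ
    rootFinset (sievePoly D g j)).image fun x => x.1 * x.2) (N * N) ?_ ?_
  · intro h g hg
    refine Finset.card_image_le.trans ?_
    rw [Finset.card_product, sievePoly_forgetCoeff]
    have := (card_rootFinset_le (sievePoly D g j)).trans (hN h g hg).le
    exact Nat.mul_le_mul this this
  · rintro h g hg ⟨y, z, hy, hz, hyz⟩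
    have h0 := (monic_sievePoly D (fun i => (hg i).1) j).ne_zero
    refine ⟨y * z, Finset.mem_image.2 ⟨(y, z), ?_, rfl⟩, hyz⟩
    rw [sievePoly_forgetCoeff, Finset.mem_product, mem_rootFinset h0, mem_rootFinset h0]
    exact ⟨hy, hz⟩

theorem negligible_coeff_one {d : Fin c → ℕ} {j : Fin c} (hd : 1 ≤ d j) :
    Negligible d fun g => (g j).coeff 1 = 0 := by
  rcases hd.eq_or_lt with h1 | h1
  -- In degree one, this coefficient is the leading one.
  · refine ⟨0, fun h => ?_⟩
    have : {g ∈ tuples d h | (g j).coeff 1 = 0} = ∅ := by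
      ext g
      simp only [Set.mem_ofPred_eq, Set.mem_empty_iff_false, iff_false, not_and]
      intro hg h0
      have := (hg j).1.coeff_natDegree
      rw [(hg j).2.1, ← h1, h0] at this
      exact zero_ne_one this
    simp [this]
  · exact negligible_of_coeff_mem h1 (fun _ => {0}) 1 (fun _ _ _ => by simp)
      fun _ g _ h0 => by simp [h0]

/-- The polynomial `p(ζ x) - p(x)`, in which the constant coefficient of `p` cancels. -/
def twistDiff (p : ℤ[X]) (ζ : AlgebraicClosure ℚ) : (AlgebraicClosure ℚ)[X] :=
  (p.map (algebraMap ℤ _)).comp (C ζ * X) - p.map (algebraMap ℤ _)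

theorem coeff_twistDiff (p : ℤ[X]) (ζ : AlgebraicClosure ℚ) (k : ℕ) :
    (twistDiff p ζ).coeff k = p.coeff k * (ζ ^ k - 1) := by
  simp [twistDiff, comp_C_mul_X_coeff, mul_sub]

theorem eval_twistDiff (p : ℤ[X]) (ζ β : AlgebraicClosure ℚ) :
    (twistDiff p ζ).eval β = aeval (ζ * β) p - aeval β p := by
  simp [twistDiff]

theorem twistDiff_erase_zero (p : ℤ[X]) (ζ : AlgebraicClosure ℚ) :
    twistDiff (p.erase 0) ζ = twistDiff p ζ := by
  ext k
  rw [coeff_twistDiff, coeff_twistDiff, coeff_erase]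
  split_ifs with h
  · simp [h]
  · rfl

theorem natDegree_twistDiff_le (p : ℤ[X]) (ζ : AlgebraicClosure ℚ) :
    (twistDiff p ζ).natDegree ≤ p.natDegree :=
  natDegree_le_iff_coeff_eq_zero.2 fun k hk => by
    rw [coeff_twistDiff, coeff_eq_zero_of_natDegree_lt hk, Int.cast_zero, zero_mul]

/-- If `β` and `ζ β` are roots of `g j`, then `β` is a root of `twistDiff (g j) ζ`. This polynomial
is nonzero when `ζ ≠ 1` and the coefficient of `x` in `g j` does not vanish. -/
theorem negligible_twist {d : Fin c → ℕ} {j : Fin c} (hd : 1 ≤ d j) (D : ℕ) :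
    Negligible d fun g => ∃ (β ζ : AlgebraicClosure ℚ) (m : ℕ), 1 ≤ m ∧ m ≤ D ∧ ζ ^ m = 1 ∧
      ζ ≠ 1 ∧ aeval β (g j) = 0 ∧ aeval (ζ * β) (g j) = 0 := by
  classical
  set U : Finset (AlgebraicClosure ℚ) := rootFinset (∏ m ∈ Finset.Icc 1 D, (X ^ m - 1 : ℤ[X]))
    with hU
  suffices h : Negligible d fun g => (g j).coeff 1 ≠ 0 ∧
      ∃ (β ζ : AlgebraicClosure ℚ), ζ ∈ U ∧ ζ ≠ 1 ∧ aeval β (g j) = 0 ∧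
        aeval (ζ * β) (g j) = 0 by
    refine ((negligible_coeff_one hd).or h).mono ?_
    rintro k g - ⟨β, ζ, m, h1, hm, hζ, hne, h⟩
    refine or_iff_not_imp_left.2 fun h0 => ⟨h0, β, ζ, ?_, hne, h⟩
    rw [hU, mem_rootFinset (monic_prod_X_pow_sub_one D).ne_zero, map_prod]
    exact Finset.prod_eq_zero (Finset.mem_Icc.2 ⟨h1, hm⟩) (by simp [hζ])
  refine negligible_of_root_mem hd
    (fun g => U.biUnion fun ζ => (twistDiff (g j) ζ).roots.toFinset) (U.card * d j) ?_ ?_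
  · intro h g hg
    refine Finset.card_biUnion_le_card_mul _ _ _ fun ζ _ => ?_
    rw [forgetCoeff, Function.update_self, twistDiff_erase_zero, ← (hg j).2.1]
    exact (Multiset.toFinset_card_le _).trans ((card_roots' _).trans (natDegree_twistDiff_le _ _))
  · rintro h g hg ⟨h1, β, ζ, hζ, hne, hβ, hζβ⟩
    refine ⟨β, Finset.mem_biUnion.2 ⟨ζ, hζ, ?_⟩, hβ⟩
    rw [forgetCoeff, Function.update_self, twistDiff_erase_zero, Multiset.mem_toFinset,
      mem_roots', IsRoot, eval_twistDiff, hβ, hζβ, sub_zero]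
    refine ⟨fun h0 => ?_, rfl⟩
    have := coeff_twistDiff (g j) ζ 1
    rw [h0, coeff_zero, pow_one, eq_comm, mul_eq_zero, sub_eq_zero, Int.cast_eq_zero] at this
    exact this.elim h1 hne

theorem negligible_not_isGeneric {d : Fin c → ℕ} (hd : ∀ j, 1 ≤ d j) (D : ℕ) :
    Negligible d fun g => ¬ IsGeneric D g := by
  refine (Negligible.exists_fin fun j =>
    (negligible_mul_root (hd j) D).or (negligible_twist (hd j) D)).mono fun k g _ hg => ?_
  by_contra hcon
  push Not at hcon
  exact hg ⟨fun j y z hy hz => (hcon j).1 y z hy hz,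
    fun j β ζ m h1 hm hζ hne hβ => (hcon j).2 β ζ m h1 hm hζ hne hβ⟩

theorem tuples_nonempty (d : Fin c → ℕ) {h : ℕ} (hh : 1 ≤ h) : (tuples d h).Nonempty := by
  refine ⟨fun i => X ^ d i, fun i => ⟨monic_X_pow _, natDegree_X_pow _,
    height_le_iff.2 fun k => ?_⟩⟩
  rw [coeff_X_pow]
  split_ifs
  · simpa using hh
  · simp

/-- If the complement of a property is negligible, then the property has density one. -/
theorem Negligible.tendsto_one {d : Fin c → ℕ} {p : (Fin c → ℤ[X]) → Prop}
    (hp : Negligible d fun g => ¬ p g) :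
    Filter.Tendsto (fun h : ℕ =>
      (({g ∈ tuples d h | p g}.ncard : ℕ) : ℝ) / ((tuples d h).ncard : ℝ))
      Filter.atTop (nhds 1) := by
  obtain ⟨C, hC⟩ := hp
  have hlim : Filter.Tendsto (fun h : ℕ => 1 - (C : ℝ) * (1 / ((h : ℝ) + 1)))
      Filter.atTop (nhds 1) := by
    simpa using (tendsto_one_div_add_atTop_nhds_zero_nat.const_mul (C : ℝ)).const_sub 1
  refine tendsto_of_tendsto_of_tendsto_of_le_of_le' hlim tendsto_const_nhds ?_ ?_
  · filter_upwards [Filter.eventually_ge_atTop 1] with h hh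
    have hpos : (0 : ℝ) < (tuples d h).ncard := by
      exact_mod_cast (Set.ncard_pos (finite_tuples d h)).2 (tuples_nonempty d hh)
    have hsum : {g ∈ tuples d h | p g}.ncard + {g ∈ tuples d h | ¬ p g}.ncard =
        (tuples d h).ncard := by
      have h1 : {g ∈ tuples d h | ¬ p g} = tuples d h \ {g ∈ tuples d h | p g} := by
        ext g
        simp only [Set.mem_sdiff, Set.mem_ofPred_eq]
        tauto
      rw [h1, add_comm, Set.ncard_sdiff_add_ncard_of_subset (fun g hg => hg.1) (finite_tuples d h)]
    have hsum' : (({g ∈ tuples d h | p g}.ncard : ℕ) : ℝ) +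
        ({g ∈ tuples d h | ¬ p g}.ncard : ℕ) = ((tuples d h).ncard : ℕ) := by
      exact_mod_cast hsum
    have hb : (({g ∈ tuples d h | ¬ p g}.ncard : ℕ) : ℝ) * (h + 1) ≤ C * (tuples d h).ncard := by
      have := (Nat.mul_le_mul_left {g ∈ tuples d h | ¬ p g}.ncard
        (show h + 1 ≤ 2 * h + 1 by omega)).trans (hC h)
      exact_mod_cast this
    have hh1 : (0 : ℝ) < (h : ℝ) + 1 := by positivity
    rw [le_div_iff₀ hpos]
    rw [sub_mul, one_mul]
    have : (({g ∈ tuples d h | ¬ p g}.ncard : ℕ) : ℝ) ≤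
        C * (1 / ((h : ℝ) + 1)) * (tuples d h).ncard := by
      rw [mul_one_div, div_mul_eq_mul_div, le_div_iff₀ hh1]
      exact hb
    linarith
  · refine Filter.Eventually.of_forall fun h => div_le_one_of_le₀ ?_ (Nat.cast_nonneg _)
    have hsub : {g ∈ tuples d h | p g} ⊆ tuples d h := fun g hg => hg.1
    exact_mod_cast Set.ncard_le_ncard hsub (finite_tuples d h)

end Higman

end

theorem mainTheorem3 (c : ℕ) (hc : 1 ≤ c) (d n : Fin c → ℕ)
    (hd : ∀ i, 1 ≤ d i) (hn : ∀ i, 1 ≤ n i) :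
    Filter.Tendsto (fun h : ℕ => Higman.prob d n h) Filter.atTop (nhds 1) := by
  refine Higman.Negligible.tendsto_one ((Higman.negligible_not_isGeneric hd _).mono
    fun h g hg hbad hG => hbad (hG.isSolvable_and_length_nestedProduct hc hd hn
      (fun i => (hg i).1) fun i => (hg i).2.1))
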